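/- Let $-\infty<a<b<\infty$, $d\ge 1$, $\alpha\in(0,1]$, $K,L\in(0,\infty)$, $H\in\mathbb{R}$, and let $R<\infty$ satisfy $$R\ \ge\ e^{K(b-a)}(1+K)\max\{e^{K(b-a)}+K(b-a),\,2\}.$$ (This includes $R=R_2:=\max\{R_1,K_2(1+K)\}$ with $R_1=e^{K(b-a)}(1+K)(e^{K(b-a)}+K(b-a))$, $K_2=2e^{(K+1)(b-a)}$, and the value $R_2:=e^{K(b-a)}(1+K)\max\{e^{K(b-a)}+K(b-a),2\}$.) Let $\|\cdot\|$ be the Euclidean norm on $\mathbb{R}^d$. Let $F=F_R^{\alpha,1}$ be the class of all pairs $(\xi,g)$ with $\xi\in\mathbb{R}^d$, $\|\xi\|\le K$, and $g:[a,b]\times\mathbb{R}^d\to\mathbb{R}^d$ continuous such that * $\|g(t,y)\|\le K(1+\|y\|)$ for all $(t,y)\in[a,b]\times\mathbb{R}^d$; * $\langle y_1-y_2,\,g(t,y_1)-g(t,y_2)\rangle\le H\|y_1-y_2\|^2$ for all $t\in[a,b]$, $\|y_1\|,\|y_2\|\le R$; * $\|g(t_1,y_1)-g(t_2,y_2)\|\le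 L(|t_1-t_2|^{\alpha}+\|y_1-y_2\|)$ for all $t_1,t_2\in[a,b]$, $\|y_1\|,\|y_2\|\le R$. Assume $H\ge -L$ and $HR>-K(1+R)$ (both hold if $H\ge 0$). (If one of them fails, then $F$ is empty or all $g$ occurring in $F$ coincide on $[a,b]\times\{\|y\|\le R\}$.) For $\delta\ge 0$ let $V_{(\xi,g)}(\delta)$ be the set of all $(\tilde\xi,\tilde g)$ with $\|\tilde\xi-\xi\|\le\delta$ and $\tilde g=g+\eta$, where $\eta:[a,b]\times\mathbb{R}^d\to\mathbb{R}^d$ is Borel measurable and $\|\eta(t,y)\|\le\delta(1+\|y\|)$ for all $(t,y)$. Let $\Phi_n$ be the set of all algorithms $\mathcal{A}(\tilde\xi,\tilde g)=\varphi(\tilde g(t_0,y_0),\dots,\tilde g(t_{i-1},y_{i-1}),\tilde\xi)$ with $i\le n$ evaluations, where $(t_0,y_0)=\psi_0(\tilde\xi)$, $(t_j,y_j)=\psi_j(\tilde g(t_0,y_0),\dots,\tilde g(t_{j-1},y_{j-1}),\tilde\xi)\in[a,b]\times\mathbb{R}^d$, the $\psi_j$ are arbitrary functions, and $\varphi$ is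 an arbitrary function with values in the bounded functions $[a,b]\to\mathbb{R}^d$. Then for every $(\xi,g)\in F$ the problem $z'(t)=g(t,z(t))$, $t\in[a,b]$, $z(a)=\xi$ has a unique solution $z(\xi,g)$. Put $$e(\mathcal{A},F,\delta)=\sup_{(\xi,g)\in F}\ \sup_{(\tilde\xi,\tilde g)\in V_{(\xi,g)}(\delta)}\ \sup_{a\le t\le b}\|z(\xi,g)(t)-\mathcal{A}(\tilde\xi,\tilde g)(t)\|,\qquad e_n(F,\delta)=\inf_{\mathcal{A}\in\Phi_n}e(\mathcal{A},F,\delta).$$ Then $e_n(F,\delta)=\Theta(n^{-\alpha}+\delta)$ as $n\to\infty$, $\delta\to0^+$: there are $c,C>0$, $n_0\in\mathbb{N}$ and $\delta_0>0$, depending only on $a,b,d,\alpha,K,H,L,R$, such that $$c\,(n^{-\alpha}+\delta)\ \le\ e_n(F,\delta)\ \le\ C\,(n^{-\alpha}+\delta)\qquad\text{for all } n\ge n_0,\ 0\le\delta\le\delta_0 .$$ The Euler method attains this order. Let $h=(b-a)/n$, $t_k=a+kh$, $\tilde y_0=\tilde\xi$, $\tilde y_{k+1}=\tilde y_k+h\,\tilde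 g(t_k,\tilde y_k)$ and $\tilde l_n(t)=\tilde y_k+(t-t_k)\tilde g(t_k,\tilde y_k)$ for $t\in[t_k,t_{k+1}]$, $0\le k\le n-1$. Then $\tilde l_n\in\Phi_n$ for all $n\ge 1$, and $e(\tilde l_n,F,\delta)\le C(n^{-\alpha}+\delta)$ for all $n\ge n_0$, $0\le\delta\le\delta_0$. -/

import Mathlib

noncomputable section

namespace NoisyODE

open scoped ENNReal

/-- The space `ℝᵈ` with the Euclidean norm. -/
abbrev Vec (d : ℕ) : Type := EuclideanSpace ℝ (Fin d)

/-- Functions `[a,b] × ℝᵈ → ℝᵈ`. -/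
abbrev RHS (a b : ℝ) (d : ℕ) : Type := Set.Icc a b × Vec d → Vec d

/-- `z : [a,b] → ℝᵈ` solves `z'(t) = g(t, z(t))` on `[a,b]`, `z(a) = ξ` (one-sided derivatives at
the end points). The derivative is that of some function on `ℝ` that extends `z`. -/
def IsSolution {a b : ℝ} {d : ℕ} (ξ : Vec d) (g : RHS a b d) (z : Set.Icc a b → Vec d) : Prop :=
  ∃ Z : ℝ → Vec d, (∀ t : Set.Icc a b, Z t = z t) ∧ Z a = ξ ∧
    ∀ t : Set.Icc a b, HasDerivWithinAt Z (g (t, z t)) (Set.Icc a b) t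

open Classical in
/-- The solution `z(ξ,g)` of the initial value problem
(the zero function if there is no solution). -/
def solution {a b : ℝ} {d : ℕ} (ξ : Vec d) (g : RHS a b d) : Set.Icc a b → Vec d :=
  if h : ∃ z, IsSolution ξ g z then Classical.choose h else 0

/-- The class `F_R^{α,β}(a,b,d,K,H,L)` of pairs `(ξ, g)`. -/
structure InClass (a b : ℝ) (d : ℕ) (α β K H L R : ℝ) (ξ : Vec d) (g : RHS a b d) : Prop where
  norm_init_le : ‖ξ‖ ≤ K
  continuous : Continuous g
  linear_growth : ∀ (t : Set.Icc a b) (y : Vec d), ‖g (t, y)‖ ≤ K * (1 + ‖y‖)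
  one_sided : ∀ (t : Set.Icc a b) (y₁ y₂ : Vec d), ‖y₁‖ ≤ R → ‖y₂‖ ≤ R →
    inner ℝ (y₁ - y₂) (g (t, y₁) - g (t, y₂)) ≤ H * ‖y₁ - y₂‖ ^ 2
  holder : ∀ (t₁ t₂ : Set.Icc a b) (y₁ y₂ : Vec d), ‖y₁‖ ≤ R → ‖y₂‖ ≤ R →
    ‖g (t₁, y₁) - g (t₂, y₂)‖ ≤ L * (|(t₁ : ℝ) - t₂| ^ α + ‖y₁ - y₂‖ ^ β)

/-- `F_R^{α,β}(a,b,d,K,H,L)` as a set. -/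
def problemClass (a b : ℝ) (d : ℕ) (α β K H L R : ℝ) : Set (Vec d × RHS a b d) :=
  {p | InClass a b d α β K H L R p.1 p.2}

/-- The set `𝒦(δ)` of corrupting functions. -/
def corruptions (a b : ℝ) (d : ℕ) (δ : ℝ) : Set (RHS a b d) :=
  {η | Measurable η ∧ ∀ (t : Set.Icc a b) (y : Vec d), ‖η (t, y)‖ ≤ δ * (1 + ‖y‖)}

/-- The set `V_{(ξ,g)}(δ)` of noisy versions `(ξ̃, g̃)` of `(ξ, g)`. -/
def noisyData {a b : ℝ} {d : ℕ} (ξ : Vec d) (g : RHS a b d) (δ : ℝ) : Set (Vec d × RHS a b d) :=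
  {q | ‖q.1 - ξ‖ ≤ δ ∧ ∃ η ∈ corruptions a b d δ, q.2 = g + η}

/-- A map that sends data `(ξ̃, g̃)` to an approximation `[a,b] → ℝᵈ` of the solution. -/
abbrev Method (a b : ℝ) (d : ℕ) : Type := Vec d → RHS a b d → Set.Icc a b → Vec d

/-- An adaptive algorithm that makes `card` evaluations. `point j` is `ψ_j`: it chooses the
evaluation point number `j` from the `j` values observed so far and `ξ̃`. `out` is `φ`: it maps the
observed values and `ξ̃` to a bounded function on `[a,b]`. -/
structure Algorithm (a b : ℝ) (d : ℕ) where
  card : ℕ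
  point : (j : ℕ) → (Fin j → Vec d) → Vec d → Set.Icc a b × Vec d
  out : (Fin card → Vec d) → Vec d → Set.Icc a b → Vec d
  out_bounded : ∀ v x, ∃ M : ℝ, ∀ t, ‖out v x t‖ ≤ M

/-- The first `j` values of `g` observed by the algorithm `A` started with initial value `x`. -/
def Algorithm.observed {a b : ℝ} {d : ℕ} (A : Algorithm a b d) (x : Vec d) (g : RHS a b d) :
    (j : ℕ) → Fin j → Vec d
  | 0 => Fin.elim0
  | j + 1 => Fin.snoc (α := fun _ => Vec d) (A.observed x g j)
      (g (A.point j (A.observed x g j) x))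

/-- The output of the algorithm on the data `(x, g)`. -/
def Algorithm.run {a b : ℝ} {d : ℕ} (A : Algorithm a b d) : Method a b d :=
  fun x g => A.out (A.observed x g A.card) x

/-- `Φ_n`: the methods that are given by algorithms with at most `n` evaluations. -/
def methods (a b : ℝ) (d n : ℕ) : Set (Method a b d) :=
  {M | ∃ A : Algorithm a b d, A.card ≤ n ∧ A.run = M}

/-- `e(M, ξ, g, δ)`. -/
def error {a b : ℝ} {d : ℕ} (M : Method a b d) (ξ : Vec d) (g : RHS a b d) (δ : ℝ) : ℝ≥0∞ :=
  ⨆ q ∈ noisyData ξ g δ, ⨆ t : Set.Icc a b, ‖solution ξ g t - M q.1 q.2 t‖ₑ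

/-- The worst-case error `e(M, 𝒢, δ)` over a set `𝒢` of problems. -/
def worstCaseError {a b : ℝ} {d : ℕ} (M : Method a b d) (G : Set (Vec d × RHS a b d)) (δ : ℝ) :
    ℝ≥0∞ :=
  ⨆ p ∈ G, error M p.1 p.2 δ

/-- The `n`-th minimal error `e_n(𝒢, δ)`. -/
def minimalError {a b : ℝ} {d : ℕ} (n : ℕ) (G : Set (Vec d × RHS a b d)) (δ : ℝ) : ℝ≥0∞ :=
  ⨅ M ∈ methods a b d n, worstCaseError M G δ

/-- The grid point `t_k = a + k h`, `h = (b - a) / n`, as an element of `[a,b]`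
(the projection onto `[a,b]` changes nothing for `k ≤ n`). -/
def gridPoint {a b : ℝ} (hab : a ≤ b) (n k : ℕ) : Set.Icc a b :=
  Set.projIcc a b hab (a + k * ((b - a) / n))

/-- The Euler iterates `y_0 = x`, `y_{k+1} = y_k + h g(t_k, y_k)`. -/
def eulerIterate {a b : ℝ} (hab : a ≤ b) {d : ℕ} (n : ℕ) (x : Vec d) (g : RHS a b d) : ℕ → Vec d
  | 0 => x
  | k + 1 => eulerIterate hab n x g k +
      ((b - a) / n) • g (gridPoint hab n k, eulerIterate hab n x g k)

/-- An index `k ≤ n - 1` with `t ∈ [t_k, t_{k+1}]`, for `t ∈ [a,b]` and `n ≥ 1`. -/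
def cellIndex (a b : ℝ) (n : ℕ) (t : ℝ) : ℕ :=
  min ⌊(t - a) / ((b - a) / n)⌋₊ (n - 1)

/-- The Euler method with `n` steps: the piecewise linear function
`t ↦ y_k + (t - t_k) g(t_k, y_k)` for `t ∈ [t_k, t_{k+1}]`. -/
def euler {a b : ℝ} (hab : a ≤ b) (d n : ℕ) : Method a b d := fun x g t =>
  let k := cellIndex a b n t
  eulerIterate hab n x g k +
    ((t : ℝ) - gridPoint hab n k) • g (gridPoint hab n k, eulerIterate hab n x g k)

/-- The radius `e^{K(b-a)} (1 + K) max {e^{K(b-a)} + K(b-a), 2}`. -/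
def radius (a b K : ℝ) : ℝ :=
  Real.exp (K * (b - a)) * (1 + K) * max (Real.exp (K * (b - a)) + K * (b - a)) 2

end NoisyODE

end

open NoisyODE

/-!
Along a trajectory `1 + ‖z‖` grows at most like `exp (K (t - a))`, so it stays in the ball of radius
`R`, where the right-hand side is Lipschitz. Truncating the field outside that ball therefore gives
existence by Picard–Lindelöf, and uniqueness follows from Grönwall's inequality. The Euler polygon
driven by slightly noisy data stays in the same ball and satisfies the differential equation up to a
defect of order `n^{-α} + δ`, which Grönwall's inequality turns into an error of the same order.

For the lower bound, the evaluations of an algorithm cannot tell the two right-hand sides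
`κ y ± φ(t) v` from `κ y` if `φ` vanishes at the at most `n` times they use, and the initial values
`± δ v` may both be reported as `0`. A multiple of the `α`-th power of the distance to these times
and to `a` is admissible as `φ` and has integral of order `n^{-α}`, so at time `b` the two solutions
are apart by a multiple of `n^{-α} + δ`.
-/

noncomputable section

namespace NoisyODE

open MeasureTheory Metric Set Topology
open scoped NNReal

section RadialRetraction

variable {E : Type*} [NormedAddCommGroup E] [NormedSpace ℝ E] {r : ℝ}

/-- The radial retraction of a normed space onto the closed ball of radius `r ≥ 0` around `0`, used
to truncate vector fields outside that ball. -/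
def radialRetraction (r : ℝ) (y : E) : E := (r / max r ‖y‖) • y

theorem radialRetraction_of_norm_le {y : E} (hy : ‖y‖ ≤ r) : radialRetraction r y = y := by
  rcases eq_or_ne y 0 with rfl | hy0
  · exact smul_zero _
  · rw [radialRetraction, max_eq_left hy, div_self ((norm_pos_iff.2 hy0).trans_le hy).ne', one_smul]

theorem norm_radialRetraction (hr : 0 ≤ r) (y : E) : ‖radialRetraction r y‖ = min r ‖y‖ := by
  have hmax : 0 ≤ max r ‖y‖ := le_max_of_le_left hr
  rw [radialRetraction, norm_smul, Real.norm_of_nonneg (div_nonneg hr hmax), div_mul_eq_mul_div,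
    ← min_mul_max]
  rcases hmax.eq_or_lt with h0 | hpos
  · have : r = 0 := le_antisymm (h0 ▸ le_max_left _ _) hr
    simp [this]
  · exact mul_div_cancel_right₀ _ hpos.ne'

theorem norm_div_max_sub_div_max_smul_le (hr : 0 < r) (x y : E) :
    ‖(r / max r ‖x‖ - r / max r ‖y‖) • y‖ ≤ ‖x - y‖ := by
  have hx : 0 < max r ‖x‖ := lt_max_of_lt_left hr
  have : 0 < max r ‖y‖ := lt_max_of_lt_left hr
  have hfactor : r / max r ‖x‖ - r / max r ‖y‖ =
      (max r ‖y‖ - max r ‖x‖) * (r / (max r ‖x‖ * max r ‖y‖)) := by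
    field_simp
  have hle_one : r / (max r ‖x‖ * max r ‖y‖) * ‖y‖ ≤ 1 := by
    rw [div_mul_eq_mul_div, div_le_one (by positivity)]
    exact mul_le_mul (le_max_left _ _) (le_max_right _ _) (norm_nonneg _) hx.le
  calc ‖(r / max r ‖x‖ - r / max r ‖y‖) • y‖
      = |max r ‖y‖ - max r ‖x‖| * (r / (max r ‖x‖ * max r ‖y‖) * ‖y‖) := by
        rw [hfactor, norm_smul, norm_mul, Real.norm_of_nonneg (r := r / _) (by positivity),
          mul_assoc, Real.norm_eq_abs]
    _ ≤ |max r ‖y‖ - max r ‖x‖| := mul_le_of_le_one_right (abs_nonneg _) hle_one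
    _ ≤ |‖y‖ - ‖x‖| := by simpa using abs_max_sub_max_le_max r ‖y‖ r ‖x‖
    _ ≤ ‖x - y‖ := by simpa only [norm_sub_rev] using abs_norm_sub_norm_le y x

theorem lipschitzWith_radialRetraction (hr : 0 ≤ r) :
    LipschitzWith 2 (radialRetraction r : E → E) := by
  refine .of_dist_le_mul fun x y => ?_
  rcases hr.eq_or_lt with rfl | hr
  · simp [radialRetraction]
  have hsplit : radialRetraction r x - radialRetraction r y =
      (r / max r ‖x‖) • (x - y) + (r / max r ‖x‖ - r / max r ‖y‖) • y := by
    simp only [radialRetraction]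
    module
  have hscaled : ‖(r / max r ‖x‖) • (x - y)‖ ≤ ‖x - y‖ := by
    rw [norm_smul, Real.norm_of_nonneg (by positivity)]
    exact mul_le_of_le_one_left (norm_nonneg _)
      ((div_le_one (lt_max_of_lt_left hr)).2 (le_max_left _ _))
  rw [dist_eq_norm, dist_eq_norm, hsplit, NNReal.coe_ofNat, two_mul]
  exact norm_add_le_of_le hscaled (norm_div_max_sub_div_max_smul_le hr x y)

end RadialRetraction

section LinearGrowth

variable {E : Type*} [NormedAddCommGroup E] [NormedSpace ℝ E] {a b c r : ℝ}

theorem gronwallBound_self (δ c x : ℝ) :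
    gronwallBound δ c c x = (1 + δ) * Real.exp (c * x) - 1 := by
  rcases eq_or_ne c 0 with rfl | hc
  · simp [gronwallBound_K0]
  · rw [gronwallBound_of_K_ne_0 hc, div_self hc]
    ring

theorem gronwallBound_le_mul_exp {δ K ε : ℝ} (hK : 0 < K) (hε : 0 ≤ ε) (x : ℝ) :
    gronwallBound δ K ε x ≤ (δ + ε / K) * Real.exp (K * x) := by
  rw [gronwallBound_of_K_ne_0 hK.ne']
  linarith [div_nonneg hε hK.le]

theorem hasDerivWithinAt_Ici_of_Icc {f : ℝ → E} {f' : E} {t : ℝ}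
    (h : HasDerivWithinAt f f' (Icc a b) t) (ht : t ∈ Ico a b) : HasDerivWithinAt f f' (Ici t) t :=
  h.mono_of_mem_nhdsWithin (Icc_mem_nhdsGE_of_mem ht)

theorem one_add_norm_le_mul_exp {γ : ℝ → E} {v : ℝ → E → E}
    (hγ : IsIntegralCurveOn γ v (Icc a b))
    (hv : ∀ t ∈ Icc a b, ‖v t (γ t)‖ ≤ c * (1 + ‖γ t‖)) {t : ℝ} (ht : t ∈ Icc a b) :
    1 + ‖γ t‖ ≤ (1 + ‖γ a‖) * Real.exp (c * (t - a)) := by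
  have hgronwall : ‖γ t‖ ≤ gronwallBound ‖γ a‖ c c (t - a) :=
    norm_le_gronwallBound_of_norm_deriv_right_le hγ.continuousOn
      (fun s hs => hasDerivWithinAt_Ici_of_Icc (hγ s (Ico_subset_Icc_self hs)) hs) le_rfl
      (fun s hs => (hv s (Ico_subset_Icc_self hs)).trans_eq (by ring)) t ht
  rw [gronwallBound_self] at hgronwall
  linarith

theorem norm_le_of_linear_growth {γ : ℝ → E} {v : ℝ → E → E} (hc : 0 ≤ c)
    (hγ : IsIntegralCurveOn γ v (Icc a b))
    (hv : ∀ t ∈ Icc a b, ‖v t (γ t)‖ ≤ c * (1 + ‖γ t‖))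
    (hr : (1 + ‖γ a‖) * Real.exp (c * (b - a)) ≤ 1 + r) {t : ℝ} (ht : t ∈ Icc a b) : ‖γ t‖ ≤ r := by
  have hexp : (1 + ‖γ a‖) * Real.exp (c * (t - a)) ≤ (1 + ‖γ a‖) * Real.exp (c * (b - a)) := by
    gcongr
    exact ht.2
  linarith [one_add_norm_le_mul_exp hγ hv ht]

theorem isPicardLindelof_of_lipschitzWith {F : Type*} [NormedAddCommGroup F] (hab : a ≤ b)
    {v : ℝ → F → F} {L M : ℝ≥0} (x₀ : F) (hlip : ∀ t ∈ Icc a b, LipschitzWith L (v t))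
    (hcont : ∀ y, ContinuousOn (fun t => v t y) (Icc a b))
    (hbound : ∀ t ∈ Icc a b, ∀ y, ‖v t y‖ ≤ M) :
    IsPicardLindelof v (tmin := a) (tmax := b) ⟨a, left_mem_Icc.2 hab⟩ x₀
      (M * (b - a).toNNReal) 0 M L where
  lipschitzOnWith t ht := (hlip t ht).lipschitzOnWith
  continuousOn y _ := hcont y
  norm_le t ht y _ := hbound t ht y
  mul_max_le := by simp [hab]

theorem exists_isIntegralCurveOn_of_linear_growth [CompleteSpace E] (hab : a ≤ b)
    {v : ℝ → E → E} {L : ℝ≥0} {x₀ : E}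
    (hcont : ∀ y, ContinuousOn (fun t => v t y) (Icc a b))
    (hlip : ∀ t ∈ Icc a b, LipschitzOnWith L (v t) (closedBall 0 r))
    (hgrowth : ∀ t ∈ Icc a b, ∀ y, ‖v t y‖ ≤ c * (1 + ‖y‖))
    (hr : (1 + ‖x₀‖) * Real.exp (c * (b - a)) ≤ 1 + r) :
    ∃ γ : ℝ → E, γ a = x₀ ∧ IsIntegralCurveOn γ v (Icc a b) := by
  have hc : 0 ≤ c := by
    simpa using (norm_nonneg _).trans (hgrowth a (left_mem_Icc.2 hab) 0)
  have hr0 : 0 ≤ r := by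
    have : 1 ≤ Real.exp (c * (b - a)) := Real.one_le_exp (mul_nonneg hc (sub_nonneg.2 hab))
    nlinarith [norm_nonneg x₀]
  let w : ℝ → E → E := fun t y => v t (radialRetraction r y)
  have hw : ∀ t ∈ Icc a b, ∀ y, ‖w t y‖ ≤ c * (1 + min r ‖y‖) := fun t ht y =>
    norm_radialRetraction hr0 y ▸ hgrowth t ht _
  obtain ⟨γ, hγa, hγ⟩ := (isPicardLindelof_of_lipschitzWith hab (v := w) (L := L * 2)
    (M := (c * (1 + r)).toNNReal) x₀
    (fun t ht => lipschitzOnWith_univ.1 <| (hlip t ht).comp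
      (lipschitzWith_radialRetraction hr0).lipschitzOnWith fun y _ => by
        simp [norm_radialRetraction hr0])
    (fun y => hcont _)
    (fun t ht y => (hw t ht y).trans <| le_trans (by gcongr; exact min_le_left _ _)
      (Real.le_coe_toNNReal _))).exists_eq_forall_mem_Icc_hasDerivWithinAt₀
  have hγr : ∀ t ∈ Icc a b, ‖γ t‖ ≤ r := fun t ht =>
    norm_le_of_linear_growth (v := w) hc hγ
      (fun s hs => (hw s hs _).trans (by gcongr; exact min_le_right _ _)) (hγa ▸ hr) ht
  refine ⟨γ, hγa, fun t ht => ?_⟩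
  simpa only [w, radialRetraction_of_norm_le (hγr t ht)] using hγ t ht

theorem eqOn_of_isIntegralCurveOn {v : ℝ → E → E} {L : ℝ≥0} {s : Set E}
    (hlip : ∀ t ∈ Icc a b, LipschitzOnWith L (v t) s) {γ γ' : ℝ → E}
    (hγ : IsIntegralCurveOn γ v (Icc a b)) (hγ' : IsIntegralCurveOn γ' v (Icc a b))
    (hγs : MapsTo γ (Icc a b) s) (hγs' : MapsTo γ' (Icc a b) s) (ha : γ a = γ' a) :
    EqOn γ γ' (Icc a b) :=
  ODE_solution_unique_of_mem_Icc_right (s := fun _ => s)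
    (fun t ht => hlip t (Ico_subset_Icc_self ht)) hγ.continuousOn
    (fun t ht => hasDerivWithinAt_Ici_of_Icc (hγ t (Ico_subset_Icc_self ht)) ht)
    (fun _ ht => hγs (Ico_subset_Icc_self ht)) hγ'.continuousOn
    (fun t ht => hasDerivWithinAt_Ici_of_Icc (hγ' t (Ico_subset_Icc_self ht)) ht)
    (fun _ ht => hγs' (Ico_subset_Icc_self ht)) ha

end LinearGrowth

section Solution

variable {a b : ℝ} {d : ℕ} {α β K H L R : ℝ} {ξ : Vec d} {g : RHS a b d}

/-- The right-hand side `g` as a time-dependent vector field on the whole real line, constant in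
time outside `[a,b]`. -/
def extendTime (hab : a ≤ b) (g : RHS a b d) (t : ℝ) (y : Vec d) : Vec d :=
  g (projIcc a b hab t, y)

theorem extendTime_of_mem (hab : a ≤ b) (g : RHS a b d) {t : ℝ} (ht : t ∈ Icc a b) (y : Vec d) :
    extendTime hab g t y = g (⟨t, ht⟩, y) := by
  rw [extendTime, projIcc_of_mem hab ht]

theorem isSolution_iff_exists_isIntegralCurveOn (hab : a ≤ b) {z : Icc a b → Vec d} :
    IsSolution ξ g z ↔ ∃ Z : ℝ → Vec d, (∀ t : Icc a b, Z t = z t) ∧ Z a = ξ ∧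
      IsIntegralCurveOn Z (extendTime hab g) (Icc a b) := by
  refine exists_congr fun Z => and_congr_right fun hZz => and_congr_right fun _ =>
    Subtype.forall.trans (forall₂_congr fun t ht => ?_)
  rw [extendTime_of_mem hab g ht, hZz ⟨t, ht⟩]

namespace InClass

theorem nonneg (hg : InClass a b d α β K H L R ξ g) : 0 ≤ K :=
  (norm_nonneg ξ).trans hg.norm_init_le

theorem lipschitzOnWith_extendTime (hg : InClass a b d α 1 K H L R ξ g) (hab : a ≤ b)
    (hα : α ≠ 0) (t : ℝ) :
    LipschitzOnWith L.toNNReal (extendTime hab g t) (closedBall 0 R) :=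
  .of_dist_le_mul fun x hx y hy => by
    have hholder := hg.holder (projIcc a b hab t) (projIcc a b hab t) x y
      (mem_closedBall_zero_iff.1 hx) (mem_closedBall_zero_iff.1 hy)
    rw [sub_self, abs_zero, Real.zero_rpow hα, zero_add, Real.rpow_one] at hholder
    rw [dist_eq_norm, dist_eq_norm]
    exact hholder.trans (by gcongr; exact Real.le_coe_toNNReal L)

theorem one_add_norm_init_mul_exp_le (hg : InClass a b d α β K H L R ξ g)
    (hR : (1 + K) * Real.exp (K * (b - a)) ≤ 1 + R) :
    (1 + ‖ξ‖) * Real.exp (K * (b - a)) ≤ 1 + R := by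
  refine le_trans ?_ hR
  gcongr
  exact hg.norm_init_le

theorem norm_integralCurve_le (hg : InClass a b d α β K H L R ξ g) (hab : a ≤ b)
    (hR : (1 + K) * Real.exp (K * (b - a)) ≤ 1 + R) {Z : ℝ → Vec d} (hZa : Z a = ξ)
    (hZ : IsIntegralCurveOn Z (extendTime hab g) (Icc a b)) {t : ℝ} (ht : t ∈ Icc a b) :
    ‖Z t‖ ≤ R :=
  norm_le_of_linear_growth hg.nonneg hZ (fun _ _ => hg.linear_growth _ _)
    (hZa ▸ hg.one_add_norm_init_mul_exp_le hR) ht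

theorem eq_of_isSolution (hg : InClass a b d α 1 K H L R ξ g) (hab : a ≤ b) (hα : α ≠ 0)
    (hR : (1 + K) * Real.exp (K * (b - a)) ≤ 1 + R) {z w : Icc a b → Vec d}
    (hz : IsSolution ξ g z) (hw : IsSolution ξ g w) : z = w := by
  obtain ⟨Z, hZz, hZa, hZ⟩ := (isSolution_iff_exists_isIntegralCurveOn hab).1 hz
  obtain ⟨W, hWw, hWa, hW⟩ := (isSolution_iff_exists_isIntegralCurveOn hab).1 hw
  have hZW : EqOn Z W (Icc a b) :=
    eqOn_of_isIntegralCurveOn (fun t _ => hg.lipschitzOnWith_extendTime hab hα t) hZ hW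
      (fun _ ht => mem_closedBall_zero_iff.2 (hg.norm_integralCurve_le hab hR hZa hZ ht))
      (fun _ ht => mem_closedBall_zero_iff.2 (hg.norm_integralCurve_le hab hR hWa hW ht))
      (hZa.trans hWa.symm)
  funext t
  rw [← hZz, ← hWw, hZW t.2]

theorem exists_isSolution (hg : InClass a b d α 1 K H L R ξ g) (hab : a ≤ b) (hα : α ≠ 0)
    (hR : (1 + K) * Real.exp (K * (b - a)) ≤ 1 + R) : ∃ z, IsSolution ξ g z := by
  obtain ⟨Z, hZa, hZ⟩ := exists_isIntegralCurveOn_of_linear_growth hab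
    (fun y => (hg.continuous.comp (continuous_projIcc.prodMk continuous_const)).continuousOn)
    (fun t _ => hg.lipschitzOnWith_extendTime hab hα t) (fun _ _ _ => hg.linear_growth _ _)
    (hg.one_add_norm_init_mul_exp_le hR)
  exact ⟨fun t => Z t, (isSolution_iff_exists_isIntegralCurveOn hab).2 ⟨Z, fun _ => rfl, hZa, hZ⟩⟩

theorem existsUnique_isSolution (hg : InClass a b d α 1 K H L R ξ g) (hab : a ≤ b) (hα : α ≠ 0)
    (hR : (1 + K) * Real.exp (K * (b - a)) ≤ 1 + R) : ∃! z, IsSolution ξ g z :=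
  existsUnique_of_exists_of_unique (hg.exists_isSolution hab hα hR) fun _ _ =>
    hg.eq_of_isSolution hab hα hR

theorem isSolution_solution (hg : InClass a b d α 1 K H L R ξ g) (hab : a ≤ b) (hα : α ≠ 0)
    (hR : (1 + K) * Real.exp (K * (b - a)) ≤ 1 + R) : IsSolution ξ g (solution ξ g) := by
  have h := hg.exists_isSolution hab hα hR
  rw [solution, dif_pos h]
  exact h.choose_spec

theorem exists_isIntegralCurveOn_solution (hg : InClass a b d α 1 K H L R ξ g) (hab : a ≤ b)
    (hα : α ≠ 0) (hR : (1 + K) * Real.exp (K * (b - a)) ≤ 1 + R) :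
    ∃ Z : ℝ → Vec d, (∀ t : Icc a b, Z t = solution ξ g t) ∧ Z a = ξ ∧
      IsIntegralCurveOn Z (extendTime hab g) (Icc a b) ∧ ∀ t ∈ Icc a b, ‖Z t‖ ≤ R := by
  obtain ⟨Z, hZz, hZa, hZ⟩ :=
    (isSolution_iff_exists_isIntegralCurveOn hab).1 (hg.isSolution_solution hab hα hR)
  exact ⟨Z, hZz, hZa, hZ, fun _ ht => hg.norm_integralCurve_le hab hR hZa hZ ht⟩

end InClass

end Solution

section EulerAlgorithm

variable {a b : ℝ} {d n : ℕ}

theorem cellIndex_lt (hn : n ≠ 0) (t : ℝ) : cellIndex a b n t < n :=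
  (min_le_right _ _).trans_lt (Nat.sub_one_lt hn)

/-- The value at time `t` of the Euler polygon with `n` steps and initial value `x`, computed from
the slopes `v` on its `n` cells. -/
def eulerOutput (hab : a ≤ b) (hn : n ≠ 0) (v : Fin n → Vec d) (x : Vec d) (t : Icc a b) : Vec d :=
  x + ((b - a) / n) • ∑ i : Fin (cellIndex a b n t), v (i.castLE (cellIndex_lt hn t).le) +
    ((t : ℝ) - gridPoint hab n (cellIndex a b n t)) • v ⟨cellIndex a b n t, cellIndex_lt hn t⟩

theorem norm_eulerOutput_le (hab : a ≤ b) (hn : n ≠ 0) (v : Fin n → Vec d) (x : Vec d)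
    (t : Icc a b) :
    ‖eulerOutput hab hn v x t‖ ≤ ‖x‖ + (b - a) / n * (n * ‖v‖) + (b - a) * ‖v‖ := by
  have hstep : 0 ≤ (b - a) / n := div_nonneg (sub_nonneg.2 hab) n.cast_nonneg
  have hsum : ‖∑ i : Fin (cellIndex a b n t), v (i.castLE (cellIndex_lt hn t).le)‖ ≤ n * ‖v‖ :=
    calc _ ≤ ∑ _i : Fin (cellIndex a b n t), ‖v‖ :=
          norm_sum_le_of_le _ fun i _ => norm_le_pi_norm v _
      _ = cellIndex a b n t * ‖v‖ := by simp
      _ ≤ n * ‖v‖ := by gcongr; exact (cellIndex_lt hn t).le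
  have hlen : ‖(t : ℝ) - gridPoint hab n (cellIndex a b n t)‖ ≤ b - a :=
    abs_sub_le_of_le_of_le t.2.1 t.2.2 (gridPoint hab n _).2.1 (gridPoint hab n _).2.2
  refine norm_add_le_of_le (norm_add_le_of_le le_rfl ?_) ?_
  · rw [norm_smul, Real.norm_of_nonneg hstep]
    gcongr
  · rw [norm_smul]
    exact mul_le_mul hlen (norm_le_pi_norm v _) (norm_nonneg _) (sub_nonneg.2 hab)

/-- The Euler method with `n` steps as an adaptive algorithm that makes `n` evaluations. -/
def eulerAlgorithm (hab : a ≤ b) (d : ℕ) (hn : n ≠ 0) : Algorithm a b d where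
  card := n
  point j v x := (gridPoint hab n j, x + ((b - a) / n) • ∑ i, v i)
  out := eulerOutput hab hn
  out_bounded v x := ⟨_, norm_eulerOutput_le hab hn v x⟩

theorem eulerIterate_eq_add_sum (hab : a ≤ b) (n : ℕ) (x : Vec d) (f : RHS a b d) (k : ℕ) :
    eulerIterate hab n x f k = x + ((b - a) / n) •
      ∑ i : Fin k, f (gridPoint hab n i, eulerIterate hab n x f i) := by
  induction k with
  | zero => simp [eulerIterate]
  | succ k ih =>
    rw [eulerIterate, Fin.sum_univ_castSucc, smul_add, ← add_assoc]
    simp only [Fin.val_castSucc, Fin.val_last]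
    rw [← ih]

theorem observed_eulerAlgorithm (hab : a ≤ b) (hn : n ≠ 0) (x : Vec d) (f : RHS a b d) (j : ℕ) :
    (eulerAlgorithm hab d hn).observed x f j =
      fun i : Fin j => f (gridPoint hab n i, eulerIterate hab n x f i) := by
  induction j with
  | zero => exact Subsingleton.elim _ _
  | succ j ih =>
    rw [Algorithm.observed, ih]
    funext i
    refine Fin.lastCases ?_ (fun i => ?_) i
    · rw [Fin.snoc_last, Fin.val_last]
      simp only [eulerAlgorithm]
      rw [← eulerIterate_eq_add_sum]
    · rw [Fin.snoc_castSucc, Fin.val_castSucc]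

theorem run_eulerAlgorithm (hab : a ≤ b) (hn : n ≠ 0) :
    (eulerAlgorithm hab d hn).run = euler hab d n := by
  funext x f t
  rw [Algorithm.run, observed_eulerAlgorithm]
  simp only [eulerAlgorithm, eulerOutput, euler, Fin.val_castLE]
  rw [← eulerIterate_eq_add_sum]

theorem euler_mem_methods (hab : a ≤ b) (hn : n ≠ 0) : euler hab d n ∈ methods a b d n :=
  ⟨eulerAlgorithm hab d hn, le_rfl, run_eulerAlgorithm hab hn⟩

end EulerAlgorithm

section Grid

variable {a b : ℝ} {n k : ℕ}

theorem coe_gridPoint (hab : a ≤ b) (hk : k ≤ n) :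
    (gridPoint hab n k : ℝ) = a + k * ((b - a) / n) := by
  have hstep : 0 ≤ (b - a) / n := div_nonneg (sub_nonneg.2 hab) n.cast_nonneg
  have hle : k * ((b - a) / n) ≤ b - a := by
    rw [mul_div_left_comm]
    exact mul_le_of_le_one_right (sub_nonneg.2 hab) (div_le_one_of_le₀ (by gcongr) n.cast_nonneg)
  rw [gridPoint, projIcc_of_mem hab ⟨by linarith [mul_nonneg k.cast_nonneg hstep], by linarith⟩]

theorem coe_gridPoint_zero (hab : a ≤ b) (n : ℕ) : (gridPoint hab n 0 : ℝ) = a := by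
  simp [coe_gridPoint hab n.zero_le]

theorem coe_gridPoint_self (hab : a ≤ b) (hn : n ≠ 0) : (gridPoint hab n n : ℝ) = b := by
  rw [coe_gridPoint hab le_rfl]
  field_simp
  ring

theorem coe_gridPoint_succ (hab : a ≤ b) (hk : k < n) :
    (gridPoint hab n (k + 1) : ℝ) = gridPoint hab n k + (b - a) / n := by
  rw [coe_gridPoint hab hk, coe_gridPoint hab hk.le]
  push_cast
  ring

theorem cellIndex_of_mem_Ico (hab : a < b) (hk : k < n) {t : ℝ}
    (ht : t ∈ Ico (gridPoint hab.le n k : ℝ) (gridPoint hab.le n (k + 1))) :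
    cellIndex a b n t = k := by
  have hstep : 0 < (b - a) / n := div_pos (sub_pos.2 hab) (Nat.cast_pos.2 (by lia))
  rw [coe_gridPoint_succ hab.le hk, coe_gridPoint hab.le hk.le] at ht
  have hfloor : ⌊(t - a) / ((b - a) / n)⌋₊ = k := by
    rw [Nat.floor_eq_iff (div_nonneg _ hstep.le), le_div_iff₀ hstep, div_lt_iff₀ hstep]
    · constructor <;> linarith [ht.1, ht.2]
    · linarith [ht.1, mul_nonneg k.cast_nonneg hstep.le]
  rw [cellIndex, hfloor, min_eq_left (Nat.le_sub_one_of_lt hk)]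

theorem cellIndex_right (hab : a < b) (n : ℕ) : cellIndex a b n b = n - 1 := by
  have hfloor : ⌊(b - a) / ((b - a) / n)⌋₊ = n := by
    rw [div_div_cancel₀ (sub_pos.2 hab).ne', Nat.floor_natCast]
  rw [cellIndex, hfloor, min_eq_right (Nat.sub_le n 1)]

theorem mem_Ico_gridPoint_cellIndex (hab : a < b) (hn : n ≠ 0) {t : ℝ} (ht : t ∈ Ico a b) :
    t ∈ Ico (gridPoint hab.le n (cellIndex a b n t) : ℝ)
      (gridPoint hab.le n (cellIndex a b n t + 1)) := by
  have hstep : 0 < (b - a) / n := div_pos (sub_pos.2 hab) (Nat.cast_pos.2 (Nat.pos_of_ne_zero hn))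
  have hquot : 0 ≤ (t - a) / ((b - a) / n) := div_nonneg (sub_nonneg.2 ht.1) hstep.le
  have hfloor : cellIndex a b n t = ⌊(t - a) / ((b - a) / n)⌋₊ := by
    refine min_eq_left (Nat.le_sub_one_of_lt ((Nat.floor_lt hquot).2 ?_))
    rw [div_lt_iff₀ hstep, mul_div_cancel₀ _ (Nat.cast_ne_zero.2 hn)]
    linarith [ht.2]
  have hlower := Nat.floor_le hquot
  have hupper := Nat.lt_floor_add_one ((t - a) / ((b - a) / n))
  rw [← hfloor, le_div_iff₀ hstep] at hlower
  rw [← hfloor, div_lt_iff₀ hstep] at hupper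
  rw [coe_gridPoint_succ hab.le (cellIndex_lt hn t), coe_gridPoint hab.le (cellIndex_lt hn t).le]
  constructor <;> linarith

theorem mem_Icc_gridPoint_cellIndex (hab : a < b) (hn : n ≠ 0) {t : ℝ} (ht : t ∈ Icc a b) :
    t ∈ Icc (gridPoint hab.le n (cellIndex a b n t) : ℝ)
      (gridPoint hab.le n (cellIndex a b n t + 1)) := by
  rcases ht.2.lt_or_eq with hlt | rfl
  · exact Ico_subset_Icc_self (mem_Ico_gridPoint_cellIndex hab hn ⟨ht.1, hlt⟩)
  · rw [cellIndex_right hab, Nat.sub_add_cancel (Nat.one_le_iff_ne_zero.2 hn),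
      coe_gridPoint_self hab.le hn]
    exact right_mem_Icc.2 (gridPoint hab.le n _).2.2

end Grid

section EulerPolygon

variable {a b c : ℝ} {d n k : ℕ} {x : Vec d} {f : RHS a b d}

/-- The slope `f (t_k, y_k)` of the Euler polygon on the cell that contains `t`. -/
def eulerSlope (hab : a ≤ b) (n : ℕ) (x : Vec d) (f : RHS a b d) (t : ℝ) : Vec d :=
  f (gridPoint hab n (cellIndex a b n t), eulerIterate hab n x f (cellIndex a b n t))

/-- The Euler polygon as a curve on the whole real line, constant outside `[a,b]`. -/
def eulerPolygon (hab : a ≤ b) (n : ℕ) (x : Vec d) (f : RHS a b d) : ℝ → Vec d :=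
  IccExtend hab (euler hab d n x f)

theorem eulerPolygon_eq (hab : a ≤ b) {t : ℝ} (ht : t ∈ Icc a b) :
    eulerPolygon hab n x f t = eulerIterate hab n x f (cellIndex a b n t) +
      (t - gridPoint hab n (cellIndex a b n t)) • eulerSlope hab n x f t :=
  IccExtend_of_mem hab _ ht

theorem eulerPolygon_left (hab : a ≤ b) : eulerPolygon hab n x f a = x := by
  have hcell : cellIndex a b n a = 0 := by simp [cellIndex]
  simp [eulerPolygon_eq hab (left_mem_Icc.2 hab), hcell, coe_gridPoint_zero, eulerIterate]

theorem eulerIterate_succ (hab : a ≤ b) (hk : k < n) :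
    eulerIterate hab n x f (k + 1) = eulerIterate hab n x f k +
      ((gridPoint hab n (k + 1) : ℝ) - gridPoint hab n k) •
        f (gridPoint hab n k, eulerIterate hab n x f k) := by
  rw [eulerIterate, coe_gridPoint_succ hab hk, add_sub_cancel_left]

theorem eulerPolygon_of_mem_cell (hab : a < b) (hk : k < n) {t : ℝ}
    (ht : t ∈ Icc (gridPoint hab.le n k : ℝ) (gridPoint hab.le n (k + 1))) :
    eulerPolygon hab.le n x f t = eulerIterate hab.le n x f k +
      (t - gridPoint hab.le n k) •
        f (gridPoint hab.le n k, eulerIterate hab.le n x f k) := by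
  have htab : t ∈ Icc a b :=
    Icc_subset_Icc (gridPoint hab.le n k).2.1 (gridPoint hab.le n (k + 1)).2.2 ht
  rw [eulerPolygon_eq hab.le htab, eulerSlope]
  rcases ht.2.lt_or_eq with hlt | heq
  · rw [cellIndex_of_mem_Ico hab hk ⟨ht.1, hlt⟩]
  rcases (Nat.succ_le_of_lt hk).lt_or_eq with hk' | hk'
  · have hlt : (gridPoint hab.le n (k + 1) : ℝ) < gridPoint hab.le n (k + 1 + 1) := by
      rw [coe_gridPoint_succ hab.le hk']
      have : 0 < (b - a) / n := div_pos (sub_pos.2 hab) (Nat.cast_pos.2 (by lia))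
      linarith
    rw [cellIndex_of_mem_Ico hab hk' ⟨heq.ge, heq ▸ hlt⟩, heq, sub_self, zero_smul, add_zero,
      eulerIterate_succ hab.le hk]
  · have htb : t = b := by
      rw [heq]
      exact hk' ▸ coe_gridPoint_self hab.le (by lia)
    have hcell : cellIndex a b n t = k := by
      rw [htb, cellIndex_right hab]
      lia
    rw [hcell]

theorem continuousOn_eulerPolygon (hab : a < b) (hn : n ≠ 0) :
    ContinuousOn (eulerPolygon hab.le n x f) (Icc a b) := by
  let cell : Fin n → Set ℝ := fun k => Icc (gridPoint hab.le n k : ℝ) (gridPoint hab.le n (k + 1))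
  have hcover : Icc a b ⊆ ⋃ k, cell k := fun t ht =>
    mem_iUnion.2 ⟨⟨_, cellIndex_lt hn t⟩, mem_Icc_gridPoint_cellIndex hab hn ht⟩
  refine ((locallyFinite_of_finite cell).continuousOn_iUnion (fun _ => isClosed_Icc)
    fun k => ?_).mono hcover
  refine ContinuousOn.congr (Continuous.continuousOn ?_) fun t ht =>
    eulerPolygon_of_mem_cell hab k.2 ht
  fun_prop

theorem hasDerivWithinAt_eulerPolygon (hab : a < b) (hn : n ≠ 0) {t : ℝ} (ht : t ∈ Ico a b) :
    HasDerivWithinAt (eulerPolygon hab.le n x f) (eulerSlope hab.le n x f t) (Ici t) t := by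
  have hcell := mem_Ico_gridPoint_cellIndex hab hn ht
  have hderiv : HasDerivAt (fun s : ℝ => eulerIterate hab.le n x f (cellIndex a b n t) +
      (s - gridPoint hab.le n (cellIndex a b n t)) • eulerSlope hab.le n x f t)
      (eulerSlope hab.le n x f t) t := by
    simpa using (((hasDerivAt_id t).sub_const _).smul_const (eulerSlope hab.le n x f t)).const_add
      (eulerIterate hab.le n x f (cellIndex a b n t))
  refine hderiv.hasDerivWithinAt.congr_of_eventuallyEq_of_mem ?_ self_mem_Ici
  filter_upwards [Ico_mem_nhdsGE hcell.2] with s hs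
  exact eulerPolygon_of_mem_cell hab (cellIndex_lt hn t) ⟨hcell.1.trans hs.1, hs.2.le⟩

theorem one_add_norm_add_smul_le {E : Type*} [NormedAddCommGroup E] [NormedSpace ℝ E] {y w : E}
    {s : ℝ} (hw : ‖w‖ ≤ c * (1 + ‖y‖)) (hs : 0 ≤ s) :
    1 + ‖y + s • w‖ ≤ (1 + ‖y‖) * Real.exp (c * s) := by
  have hsmul : ‖s • w‖ ≤ s * (c * (1 + ‖y‖)) := by
    rw [norm_smul, Real.norm_of_nonneg hs]
    gcongr
  calc 1 + ‖y + s • w‖ ≤ (1 + ‖y‖) * (c * s + 1) := by linarith [norm_add_le y (s • w)]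
    _ ≤ (1 + ‖y‖) * Real.exp (c * s) := by
      gcongr
      exact Real.add_one_le_exp _

theorem one_add_norm_eulerIterate_le (hab : a ≤ b) (hf : ∀ t y, ‖f (t, y)‖ ≤ c * (1 + ‖y‖))
    (hk : k ≤ n) : 1 + ‖eulerIterate hab n x f k‖ ≤
      (1 + ‖x‖) * Real.exp (c * (gridPoint hab n k - a)) := by
  induction k with
  | zero => simp [coe_gridPoint_zero, eulerIterate]
  | succ k ih =>
    have hstep : (0 : ℝ) ≤ gridPoint hab n (k + 1) - gridPoint hab n k := by
      rw [coe_gridPoint_succ hab hk, add_sub_cancel_left]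
      exact div_nonneg (sub_nonneg.2 hab) n.cast_nonneg
    rw [eulerIterate_succ hab hk]
    refine (one_add_norm_add_smul_le (hf _ _) hstep).trans ?_
    refine (mul_le_mul_of_nonneg_right (ih (Nat.le_of_succ_le hk)) (Real.exp_nonneg _)).trans_eq ?_
    rw [mul_assoc, ← Real.exp_add]
    ring_nf

theorem one_add_norm_eulerPolygon_le (hab : a < b) (hn : n ≠ 0)
    (hf : ∀ t y, ‖f (t, y)‖ ≤ c * (1 + ‖y‖)) {t : ℝ} (ht : t ∈ Icc a b) :
    1 + ‖eulerPolygon hab.le n x f t‖ ≤ (1 + ‖x‖) * Real.exp (c * (t - a)) := by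
  have hcell := mem_Icc_gridPoint_cellIndex hab hn ht
  rw [eulerPolygon_eq hab.le ht]
  refine (one_add_norm_add_smul_le (hf _ _) (sub_nonneg.2 hcell.1)).trans ?_
  refine (mul_le_mul_of_nonneg_right (one_add_norm_eulerIterate_le hab.le hf
    (cellIndex_lt hn t).le) (Real.exp_nonneg _)).trans_eq ?_
  rw [mul_assoc, ← Real.exp_add]
  ring_nf

end EulerPolygon

section EulerError

variable {a b c r α β δ K H L R : ℝ} {d n k : ℕ} {x ξ : Vec d} {f g η : RHS a b d}

theorem norm_eulerIterate_le (hab : a ≤ b) (hc : 0 ≤ c) (hf : ∀ t y, ‖f (t, y)‖ ≤ c * (1 + ‖y‖))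
    (hr : (1 + ‖x‖) * Real.exp (c * (b - a)) ≤ 1 + r) (hk : k ≤ n) :
    ‖eulerIterate hab n x f k‖ ≤ r := by
  have hexp : (1 + ‖x‖) * Real.exp (c * (gridPoint hab n k - a)) ≤
      (1 + ‖x‖) * Real.exp (c * (b - a)) := by
    gcongr
    exact (gridPoint hab n k).2.2
  linarith [one_add_norm_eulerIterate_le hab hf hk (x := x)]

theorem norm_eulerPolygon_le (hab : a < b) (hn : n ≠ 0) (hc : 0 ≤ c)
    (hf : ∀ t y, ‖f (t, y)‖ ≤ c * (1 + ‖y‖))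
    (hr : (1 + ‖x‖) * Real.exp (c * (b - a)) ≤ 1 + r) {t : ℝ} (ht : t ∈ Icc a b) :
    ‖eulerPolygon hab.le n x f t‖ ≤ r := by
  have hexp : (1 + ‖x‖) * Real.exp (c * (t - a)) ≤ (1 + ‖x‖) * Real.exp (c * (b - a)) := by
    gcongr
    exact ht.2
  linarith [one_add_norm_eulerPolygon_le hab hn hf ht (x := x)]

theorem abs_sub_gridPoint_cellIndex_le (hab : a < b) (hn : n ≠ 0) {t : ℝ} (ht : t ∈ Icc a b) :
    |t - gridPoint hab.le n (cellIndex a b n t)| ≤ (b - a) / n := by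
  have hcell := mem_Icc_gridPoint_cellIndex hab hn ht
  rw [coe_gridPoint_succ hab.le (cellIndex_lt hn t)] at hcell
  rw [abs_of_nonneg (sub_nonneg.2 hcell.1)]
  linarith [hcell.2]

theorem norm_eulerPolygon_sub_eulerIterate_le (hab : a < b) (hn : n ≠ 0) (hc : 0 ≤ c)
    (hf : ∀ t y, ‖f (t, y)‖ ≤ c * (1 + ‖y‖))
    (hr : (1 + ‖x‖) * Real.exp (c * (b - a)) ≤ 1 + r) {t : ℝ} (ht : t ∈ Icc a b) :
    ‖eulerPolygon hab.le n x f t - eulerIterate hab.le n x f (cellIndex a b n t)‖ ≤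
      (b - a) / n * (c * (1 + r)) := by
  have hslope : ‖eulerSlope hab.le n x f t‖ ≤ c * (1 + r) :=
    (hf _ _).trans (by gcongr; exact norm_eulerIterate_le hab.le hc hf hr (cellIndex_lt hn t).le)
  rw [eulerPolygon_eq hab.le ht, add_sub_cancel_left, norm_smul]
  exact mul_le_mul (abs_sub_gridPoint_cellIndex_le hab hn ht) hslope (norm_nonneg _)
    ((abs_nonneg _).trans (abs_sub_gridPoint_cellIndex_le hab hn ht))

namespace InClass

theorem norm_add_corruption_le (hg : InClass a b d α β K H L R ξ g) (hη : η ∈ corruptions a b d δ)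
    (t : Icc a b) (y : Vec d) : ‖(g + η) (t, y)‖ ≤ (K + δ) * (1 + ‖y‖) := by
  rw [add_mul]
  exact norm_add_le_of_le (hg.linear_growth t y) (hη.2 t y)

theorem norm_eulerSlope_sub_le (hg : InClass a b d α 1 K H L R ξ g) (hab : a < b) (hn : n ≠ 0)
    (hα : 0 ≤ α) (hL : 0 ≤ L) (hδ : 0 ≤ δ) (hη : η ∈ corruptions a b d δ)
    (hx : (1 + ‖x‖) * Real.exp ((K + δ) * (b - a)) ≤ 1 + R) {t : ℝ} (ht : t ∈ Icc a b) :
    ‖eulerSlope hab.le n x (g + η) t - extendTime hab.le g t (eulerPolygon hab.le n x (g + η) t)‖ ≤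
      δ * (1 + R) + L * (((b - a) / n) ^ α + (b - a) / n * ((K + δ) * (1 + R))) := by
  have hc : 0 ≤ K + δ := add_nonneg hg.nonneg hδ
  have hf := hg.norm_add_corruption_le hη
  have hyR : ‖eulerIterate hab.le n x (g + η) (cellIndex a b n t)‖ ≤ R :=
    norm_eulerIterate_le hab.le hc hf hx (cellIndex_lt hn t).le
  have hnoise : ‖η (gridPoint hab.le n (cellIndex a b n t),
      eulerIterate hab.le n x (g + η) (cellIndex a b n t))‖ ≤ δ * (1 + R) :=
    (hη.2 _ _).trans (by gcongr)
  have hfield : ‖g (gridPoint hab.le n (cellIndex a b n t),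
      eulerIterate hab.le n x (g + η) (cellIndex a b n t)) -
      g (⟨t, ht⟩, eulerPolygon hab.le n x (g + η) t)‖ ≤
      L * (((b - a) / n) ^ α + (b - a) / n * ((K + δ) * (1 + R))) := by
    refine (hg.holder _ _ _ _ hyR (norm_eulerPolygon_le hab hn hc hf hx ht)).trans ?_
    rw [Real.rpow_one, abs_sub_comm, norm_sub_rev]
    gcongr
    · exact abs_sub_gridPoint_cellIndex_le hab hn ht
    · exact norm_eulerPolygon_sub_eulerIterate_le hab hn hc hf hx ht
  rw [extendTime_of_mem hab.le g ht, eulerSlope, Pi.add_apply, add_comm (g _), add_sub_assoc]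
  exact norm_add_le_of_le hnoise hfield

theorem norm_solution_sub_euler_le (hg : InClass a b d α 1 K H L R ξ g) (hab : a < b) (hn : n ≠ 0)
    (hα : 0 < α) (hL : 0 < L) (hδ : 0 ≤ δ) (hη : η ∈ corruptions a b d δ) (hξ : ‖x - ξ‖ ≤ δ)
    (hR : (1 + (K + δ)) * Real.exp ((K + δ) * (b - a)) ≤ 1 + R) (t : Icc a b) :
    ‖solution ξ g t - euler hab.le d n x (g + η) t‖ ≤
      (δ + (δ * (1 + R) + L * (((b - a) / n) ^ α + (b - a) / n * ((K + δ) * (1 + R)))) / L) *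
        Real.exp (L * (b - a)) := by
  have : 0 ≤ b - a := sub_nonneg.2 hab.le
  have hK : 0 ≤ K := hg.nonneg
  have hx : (1 + ‖x‖) * Real.exp ((K + δ) * (b - a)) ≤ 1 + R := by
    refine le_trans ?_ hR
    gcongr
    exact (norm_le_insert' x ξ).trans (add_le_add hg.norm_init_le hξ)
  have hRK : (1 + K) * Real.exp (K * (b - a)) ≤ 1 + R := by
    refine le_trans ?_ hR
    gcongr <;> linarith
  have hR0 : 0 ≤ 1 + R := hRK.trans' (by positivity)
  obtain ⟨Z, hZsol, hZa, hZ, hZR⟩ := hg.exists_isIntegralCurveOn_solution hab.le hα.ne' hRK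
  have hgronwall := dist_le_of_approx_trajectories_ODE_of_mem
    (s := fun _ => closedBall (0 : Vec d) R) (δ := δ) (εf := 0)
    (fun t _ => hg.lipschitzOnWith_extendTime hab.le hα.ne' t) hZ.continuousOn
    (fun t ht => hasDerivWithinAt_Ici_of_Icc (hZ t (Ico_subset_Icc_self ht)) ht)
    (fun t _ => (dist_self _).le)
    (fun t ht => mem_closedBall_zero_iff.2 (hZR t (Ico_subset_Icc_self ht)))
    (continuousOn_eulerPolygon hab hn) (fun t ht => hasDerivWithinAt_eulerPolygon hab hn ht)
    (fun t ht => (dist_eq_norm _ _).trans_le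
      (hg.norm_eulerSlope_sub_le hab hn hα.le hL.le hδ hη hx (Ico_subset_Icc_self ht)))
    (fun t ht => mem_closedBall_zero_iff.2 (norm_eulerPolygon_le hab hn (add_nonneg hK hδ)
      (hg.norm_add_corruption_le hη) hx (Ico_subset_Icc_self ht)))
    (by rwa [hZa, eulerPolygon_left, dist_comm, dist_eq_norm]) t t.2
  rw [hZsol, eulerPolygon, IccExtend_val, dist_eq_norm, zero_add,
    Real.coe_toNNReal L hL.le] at hgronwall
  refine hgronwall.trans ((gronwallBound_le_mul_exp hL (by positivity) _).trans ?_)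
  gcongr
  exact t.2.2

end InClass

theorem div_natCast_rpow_eq (hab : a ≤ b) (α : ℝ) (n : ℕ) :
    ((b - a) / n) ^ α = (b - a) ^ α * (n : ℝ) ^ (-α) := by
  rw [Real.div_rpow (sub_nonneg.2 hab) n.cast_nonneg, Real.rpow_neg n.cast_nonneg, div_eq_mul_inv]

theorem div_natCast_le_mul_rpow_neg (hab : a ≤ b) (hn : n ≠ 0) (hα1 : α ≤ 1) :
    (b - a) / n ≤ (b - a) * (n : ℝ) ^ (-α) := by
  have hpow : (n : ℝ)⁻¹ ≤ (n : ℝ) ^ (-α) := by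
    rw [← Real.rpow_neg_one]
    exact Real.rpow_le_rpow_of_exponent_le (mod_cast Nat.one_le_iff_ne_zero.2 hn) (by linarith)
  exact mul_le_mul_of_nonneg_left hpow (sub_nonneg.2 hab)

theorem exists_Icc_growth_le (hR : (1 + K) * Real.exp (K * (b - a)) < 1 + R) :
    ∃ δ₀ > 0, ∀ δ ∈ Icc 0 δ₀, (1 + (K + δ)) * Real.exp ((K + δ) * (b - a)) ≤ 1 + R := by
  have hcont : Continuous fun δ => (1 + (K + δ)) * Real.exp ((K + δ) * (b - a)) := by fun_prop
  have hnear : ∀ᶠ δ in 𝓝 0, (1 + (K + δ)) * Real.exp ((K + δ) * (b - a)) < 1 + R :=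
    hcont.continuousAt.eventually_lt_const (by simpa using hR)
  obtain ⟨δ₀, hδ₀, hsub⟩ := mem_nhdsGE_iff_exists_Icc_subset.1 (mem_nhdsWithin_of_mem_nhds hnear)
  exact ⟨δ₀, hδ₀, fun δ hδ => (hsub hδ).le⟩

theorem worstCaseError_le_ofReal {M : Method a b d} {G : Set (Vec d × RHS a b d)} {C : ℝ}
    (h : ∀ p ∈ G, ∀ q ∈ noisyData p.1 p.2 δ, ∀ t, ‖solution p.1 p.2 t - M q.1 q.2 t‖ ≤ C) :
    worstCaseError M G δ ≤ ENNReal.ofReal C :=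
  iSup₂_le fun p hp => iSup₂_le fun q hq => iSup_le fun t => by
    rw [← ofReal_norm]
    exact ENNReal.ofReal_le_ofReal (h p hp q hq t)

theorem exists_worstCaseError_euler_le (hab : a < b) (d : ℕ) (hα : 0 < α) (hα1 : α ≤ 1)
    (hK : 0 ≤ K) (H : ℝ) (hL : 0 < L) (hR : (1 + K) * Real.exp (K * (b - a)) < 1 + R) :
    ∃ C > 0, ∃ δ₀ > 0, ∀ n : ℕ, n ≠ 0 → ∀ δ ∈ Icc 0 δ₀,
      worstCaseError (euler hab.le d n) (problemClass a b d α 1 K H L R) δ ≤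
        ENNReal.ofReal (C * ((n : ℝ) ^ (-α) + δ)) := by
  obtain ⟨δ₀, hδ₀, hgrowth⟩ := exists_Icc_growth_le hR
  have : 0 < b - a := sub_pos.2 hab
  have hR0 : 0 < 1 + R := hR.trans_le' (by positivity)
  refine ⟨(1 + (1 + R) / L + (b - a) ^ α + (b - a) * ((K + δ₀) * (1 + R))) *
    Real.exp (L * (b - a)), by positivity, δ₀, hδ₀, fun n hn δ hδ => ?_⟩
  refine worstCaseError_le_ofReal ?_
  rintro p hp ⟨x, _⟩ ⟨hx, η, hη, rfl⟩ t
  refine (InClass.norm_solution_sub_euler_le hp hab hn hα hL hδ.1 hη hx (hgrowth δ hδ) t).trans ?_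
  have hmesh : (b - a) / n * ((K + δ) * (1 + R)) ≤
      (b - a) * (n : ℝ) ^ (-α) * ((K + δ₀) * (1 + R)) :=
    mul_le_mul (div_natCast_le_mul_rpow_neg hab.le hn hα1)
      (by gcongr; exact hδ.2) (by have := hδ.1; positivity) (by positivity)
  rw [div_natCast_rpow_eq hab.le, add_div, mul_div_cancel_left₀ _ hL.ne', mul_right_comm]
  gcongr
  have hslack : 0 ≤ (n : ℝ) ^ (-α) * (1 + (1 + R) / L) +
      δ * ((b - a) ^ α + (b - a) * ((K + δ₀) * (1 + R))) := by
    have := hδ.1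
    positivity
  linear_combination hmesh + hslack

end EulerError

section DistanceIntegral

variable {a b r α : ℝ}

theorem abs_rpow_sub_rpow_le {x y : ℝ} (hx : 0 ≤ x) (hy : 0 ≤ y) (hα : 0 ≤ α) (hα1 : α ≤ 1) :
    |x ^ α - y ^ α| ≤ |x - y| ^ α := by
  wlog hxy : y ≤ x generalizing x y
  · rw [abs_sub_comm, abs_sub_comm x]
    exact this hy hx (le_of_not_ge hxy)
  have hsubadd := Real.rpow_add_le_add_rpow (sub_nonneg.2 hxy) hy hα hα1
  rw [sub_add_cancel] at hsubadd
  rw [abs_of_nonneg (sub_nonneg.2 (Real.rpow_le_rpow hy hxy hα)), abs_of_nonneg (sub_nonneg.2 hxy)]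
  linarith

theorem abs_infDist_rpow_sub_le {X : Type*} [PseudoMetricSpace X] (S : Set X) (hα : 0 ≤ α)
    (hα1 : α ≤ 1) (x y : X) : |infDist x S ^ α - infDist y S ^ α| ≤ dist x y ^ α := by
  refine (abs_rpow_sub_rpow_le infDist_nonneg infDist_nonneg hα hα1).trans ?_
  gcongr
  simpa [Real.dist_eq] using (lipschitz_infDist_pt S).dist_le_mul x y

theorem volume_real_thickening_finset_le (hr : 0 ≤ r) (S : Finset ℝ) :
    volume.real (thickening r (S : Set ℝ)) ≤ 2 * r * S.card := by
  rw [thickening_eq_biUnion_ball]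
  refine (measureReal_biUnion_finset_le S fun s => ball s r).trans_eq ?_
  simp [Real.volume_real_ball hr, mul_comm]

theorem rpow_mul_le_integral_infDist_rpow (hab : a ≤ b) (hr : 0 ≤ r) (hα : 0 ≤ α) {S : Finset ℝ}
    (hS : S.Nonempty) :
    r ^ α * (b - a - 2 * r * S.card) ≤ ∫ t in a..b, infDist t (S : Set ℝ) ^ α := by
  have hcont : Continuous fun t : ℝ => infDist t (S : Set ℝ) ^ α :=
    (continuous_infDist_pt _).rpow_const fun _ => Or.inr hα
  have hfar : Ioc a b \ thickening r (S : Set ℝ) ⊆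
      {t | r ^ α ≤ infDist t (S : Set ℝ) ^ α} ∩ Ioc a b := fun t ht => by
    refine ⟨Real.rpow_le_rpow hr (not_lt.1 fun hlt => ht.2 ?_) hα, ht.1⟩
    exact (mem_thickening_iff_infDist_lt (Finset.coe_nonempty.2 hS)).2 hlt
  have hfinite : volume (thickening r (S : Set ℝ)) ≠ ⊤ :=
    S.finite_toSet.isBounded.thickening.measure_lt_top.ne
  have hmeas : b - a - 2 * r * S.card ≤
      (volume.restrict (Ioc a b)).real {t | r ^ α ≤ infDist t (S : Set ℝ) ^ α} :=
    calc b - a - 2 * r * S.card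
        ≤ volume.real (Ioc a b) - volume.real (thickening r (S : Set ℝ)) := by
          rw [Real.volume_real_Ioc_of_le hab]
          gcongr
          exact volume_real_thickening_finset_le hr S
      _ ≤ volume.real (Ioc a b \ thickening r (S : Set ℝ)) := le_measureReal_sdiff hfinite
      _ ≤ volume.real ({t | r ^ α ≤ infDist t (S : Set ℝ) ^ α} ∩ Ioc a b) :=
          measureReal_mono hfar (measure_ne_top_of_subset inter_subset_right measure_Ioc_lt_top.ne)
      _ = _ := (measureReal_restrict_apply' measurableSet_Ioc).symm
  rw [intervalIntegral.integral_of_le hab]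
  refine (mul_le_mul_of_nonneg_left hmeas (Real.rpow_nonneg hr α)).trans ?_
  exact mul_meas_ge_le_integral_of_nonneg
    (.of_forall fun _ => Real.rpow_nonneg infDist_nonneg _)
    (hcont.integrableOn_Icc.mono_set Ioc_subset_Icc_self) _

theorem le_integral_infDist_insert_rpow (hab : a ≤ b) (hα : 0 ≤ α) {n : ℕ} (hn : n ≠ 0)
    {S : Finset ℝ} (hS : S.card ≤ n) :
    ((b - a) / 8) ^ α * ((b - a) / 2) * (n : ℝ) ^ (-α) ≤
      ∫ t in a..b, infDist t (insert a S : Finset ℝ) ^ α := by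
  have : 0 ≤ b - a := sub_nonneg.2 hab
  have hn0 : (0 : ℝ) < n := Nat.cast_pos.2 (Nat.pos_of_ne_zero hn)
  have hcard : ((insert a S : Finset ℝ).card : ℝ) ≤ 2 * n := by
    have := Finset.card_insert_le a S
    exact_mod_cast (by lia : (insert a S).card ≤ 2 * n)
  refine le_trans ?_ (rpow_mul_le_integral_infDist_rpow hab (r := (b - a) / 8 / n)
    (by positivity) hα (Finset.insert_nonempty a S))
  have hremaining : (b - a) / 2 ≤ b - a - 2 * ((b - a) / 8 / n) * (insert a S : Finset ℝ).card :=
    calc (b - a) / 2 = b - a - 2 * ((b - a) / 8 / n) * (2 * n) := by field_simp; ring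
      _ ≤ _ := by gcongr
  rw [Real.div_rpow (by positivity) hn0.le, mul_right_comm, Real.rpow_neg hn0.le, ← div_eq_mul_inv]
  gcongr

end DistanceIntegral

section Fooling

variable {a b α κ m δ K H L R : ℝ} {d : ℕ} {ξ v : Vec d} {φ : ℝ → ℝ}

/-- The right-hand side `κ y + φ(t) v`, truncated at radius `R` in `y`. In the lower bound, `φ v` is
the perturbation of the linear field `κ y` that an algorithm fails to see. -/
def forcedLinearRHS (a b κ R : ℝ) (v : Vec d) (φ : ℝ → ℝ) : RHS a b d :=
  fun p => κ • radialRetraction R p.2 + φ p.1 • v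

theorem mul_add_le_mul_one_add (hmK : m ≤ K) (hmR : κ * R + m ≤ K * (1 + R)) {s : ℝ} (hs : 0 ≤ s)
    (hsR : s ≤ R) : κ * s + m ≤ K * (1 + s) := by
  rcases le_total κ K with hκ | hκ
  · nlinarith
  · nlinarith

theorem norm_forcedLinearRHS_le (hR : 0 ≤ R) (hK : 0 ≤ K) (hv : ‖v‖ = 1) (hmK : m ≤ K)
    (hmR : |κ| * R + m ≤ K * (1 + R)) (hφm : ∀ t ∈ Icc a b, |φ t| ≤ m) (t : Icc a b) (y : Vec d) :
    ‖forcedLinearRHS a b κ R v φ (t, y)‖ ≤ K * (1 + ‖y‖) :=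
  calc ‖forcedLinearRHS a b κ R v φ (t, y)‖ ≤ |κ| * min R ‖y‖ + m :=
        norm_add_le_of_le
          (by rw [norm_smul, norm_radialRetraction hR, Real.norm_eq_abs])
          (by rw [norm_smul, hv, mul_one]; exact hφm t t.2)
    _ ≤ K * (1 + min R ‖y‖) :=
        mul_add_le_mul_one_add hmK hmR (le_min hR (norm_nonneg y)) (min_le_left _ _)
    _ ≤ K * (1 + ‖y‖) := by gcongr; exact min_le_right _ _

theorem inClass_forcedLinearRHS (hR : 0 ≤ R) (hξ : ‖ξ‖ ≤ K) (hv : ‖v‖ = 1) (hκL : |κ| ≤ L)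
    (hκH : κ ≤ H) (hmK : m ≤ K) (hmR : |κ| * R + m ≤ K * (1 + R)) (hφ : Continuous φ)
    (hφm : ∀ t ∈ Icc a b, |φ t| ≤ m) (hφL : ∀ s t, |φ s - φ t| ≤ L * |s - t| ^ α) :
    InClass a b d α 1 K H L R ξ (forcedLinearRHS a b κ R v φ) where
  norm_init_le := hξ
  continuous := by
    have hret : Continuous (radialRetraction R : Vec d → Vec d) :=
      (lipschitzWith_radialRetraction hR).continuous
    unfold forcedLinearRHS
    fun_prop
  linear_growth := norm_forcedLinearRHS_le hR ((norm_nonneg ξ).trans hξ) hv hmK hmR hφm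
  one_sided t y₁ y₂ hy₁ hy₂ := by
    simp only [forcedLinearRHS, radialRetraction_of_norm_le hy₁, radialRetraction_of_norm_le hy₂]
    rw [add_sub_add_right_eq_sub, ← smul_sub, real_inner_smul_right, real_inner_self_eq_norm_sq]
    gcongr
  holder t₁ t₂ y₁ y₂ hy₁ hy₂ := by
    simp only [forcedLinearRHS, radialRetraction_of_norm_le hy₁, radialRetraction_of_norm_le hy₂]
    rw [add_sub_add_comm, ← smul_sub, ← sub_smul, Real.rpow_one, add_comm, mul_add]
    refine norm_add_le_of_le ?_ ?_
    · rw [norm_smul, hv, mul_one]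
      exact hφL t₁ t₂
    · rw [norm_smul]
      gcongr
      exact hκL

theorem exists_rate_and_amplitude (hK : 0 < K) (hL : 0 ≤ L) (hR : 0 ≤ R) (hHL : -L ≤ H)
    (hHK : -(K * (1 + R)) < H * R) :
    ∃ κ m : ℝ, κ ≤ 0 ∧ |κ| ≤ L ∧ κ ≤ H ∧ 0 < m ∧ m ≤ K ∧ |κ| * R + m ≤ K * (1 + R) := by
  have hκ : min H 0 ≤ 0 := min_le_right _ _
  have hslack : 0 < K * (1 + R) + min H 0 * R := by
    rcases min_cases H 0 with ⟨h, -⟩ | ⟨h, -⟩ <;> rw [h]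
    · linarith
    · rw [zero_mul, add_zero]
      positivity
  refine ⟨min H 0, min K (K * (1 + R) + min H 0 * R), hκ, ?_, min_le_left _ _, lt_min hK hslack,
    min_le_left _ _, ?_⟩
  · rw [abs_of_nonpos hκ, neg_le]
    exact le_min hHL (neg_nonpos.2 hL)
  · rw [abs_of_nonpos hκ]
    linarith [min_le_right K (K * (1 + R) + min H 0 * R)]

theorem exp_mul_add_integral_le (hab : a ≤ b) (hκ : κ ≤ 0) (hφ : Continuous φ)
    (hφ0 : ∀ t ∈ Icc a b, 0 ≤ φ t) {u : ℝ → ℝ}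
    (hu : ∀ t ∈ Icc a b, HasDerivWithinAt u (κ * u t + φ t) (Icc a b) t) :
    Real.exp (κ * (b - a)) * (u a + ∫ t in a..b, φ t) ≤ u b := by
  let w : ℝ → ℝ := fun t => Real.exp (κ * (b - t)) * u t
  have hw : ∀ t ∈ Icc a b,
      HasDerivWithinAt w (Real.exp (κ * (b - t)) * φ t) (Icc a b) t := fun t ht => by
    have hexp : HasDerivAt (fun s => Real.exp (κ * (b - s))) (Real.exp (κ * (b - t)) * -κ) t := by
      simpa using (((hasDerivAt_id t).const_sub b).const_mul κ).exp
    exact (hexp.hasDerivWithinAt.mul (hu t ht)).congr_deriv (by ring)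
  have hint : ∫ t in a..b, Real.exp (κ * (b - a)) * φ t ≤ w b - w a := by
    refine intervalIntegral.integral_le_sub_of_hasDeriv_right_of_le hab
      (fun t ht => (hw t ht).continuousWithinAt)
      (fun t ht => ((hw t (Ioo_subset_Icc_self ht)).hasDerivAt
        (Icc_mem_nhds ht.1 ht.2)).hasDerivWithinAt)
      (by fun_prop : Continuous _).integrableOn_Icc fun t ht => ?_
    exact mul_le_mul_of_nonneg_right (Real.exp_le_exp.2 (mul_le_mul_of_nonpos_left
      (by linarith [ht.1]) hκ)) (hφ0 t (Ioo_subset_Icc_self ht))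
  rw [intervalIntegral.integral_const_mul] at hint
  simp only [w, sub_self, mul_zero, Real.exp_zero, one_mul] at hint
  linarith

theorem exp_mul_add_integral_le_inner_solution (hab : a ≤ b) (hα : α ≠ 0)
    (hR : (1 + K) * Real.exp (K * (b - a)) ≤ 1 + R) (hv : ‖v‖ = 1) (hκ : κ ≤ 0)
    (hφ : Continuous φ) (hφ0 : ∀ t ∈ Icc a b, 0 ≤ φ t)
    (hg : InClass a b d α 1 K H L R ξ (forcedLinearRHS a b κ R v φ)) :
    Real.exp (κ * (b - a)) * (inner ℝ v ξ + ∫ t in a..b, φ t) ≤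
      inner ℝ v (solution ξ (forcedLinearRHS a b κ R v φ) ⟨b, right_mem_Icc.2 hab⟩) := by
  obtain ⟨Z, hZsol, hZa, hZ, hZR⟩ := hg.exists_isIntegralCurveOn_solution hab hα hR
  have hinner : ∀ t ∈ Icc a b, HasDerivWithinAt (fun s => inner ℝ v (Z s))
      (κ * inner ℝ v (Z t) + φ t) (Icc a b) t := fun t ht => by
    refine ((innerSL ℝ v).hasFDerivAt.comp_hasDerivWithinAt t (hZ t ht)).congr_deriv ?_
    rw [extendTime_of_mem hab _ ht, forcedLinearRHS, radialRetraction_of_norm_le (hZR t ht),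
      innerSL_apply_apply, inner_add_right, real_inner_smul_right, real_inner_smul_right,
      real_inner_self_eq_norm_sq, hv, one_pow, mul_one]
  simpa only [hZa, ← hZsol] using exp_mul_add_integral_le hab hκ hφ hφ0 hinner

theorem exists_bump (hab : a < b) (hα : 0 < α) (hα1 : α ≤ 1) (hL : 0 < L) (hm : 0 < m) :
    ∃ c > 0, ∀ n : ℕ, n ≠ 0 → ∀ S : Finset ℝ, S.card ≤ n → ∃ φ : ℝ → ℝ, Continuous φ ∧
      (∀ t, 0 ≤ φ t) ∧ (∀ t ∈ Icc a b, φ t ≤ m) ∧ (∀ s t, |φ s - φ t| ≤ L * |s - t| ^ α) ∧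
      (∀ t ∈ S, φ t = 0) ∧ c * (n : ℝ) ^ (-α) ≤ ∫ t in a..b, φ t := by
  have : 0 < b - a := sub_pos.2 hab
  obtain ⟨q, hq, hqL, hqm⟩ : ∃ q > 0, q ≤ L ∧ q * (b - a) ^ α ≤ m :=
    ⟨min L (m / (b - a) ^ α), by positivity, min_le_left _ _,
      (le_div_iff₀ (by positivity)).1 (min_le_right _ _)⟩
  refine ⟨q * (((b - a) / 8) ^ α * ((b - a) / 2)), by positivity, fun n hn S hS =>
    ⟨fun t => q * infDist t (insert a S : Finset ℝ) ^ α, ?_, fun t => ?_, fun t ht => ?_,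
      fun s t => ?_, fun t ht => ?_, ?_⟩⟩
  · exact continuous_const.mul ((continuous_infDist_pt _).rpow_const fun _ => Or.inr hα.le)
  · exact mul_nonneg hq.le (Real.rpow_nonneg infDist_nonneg _)
  · have hdist : infDist t (insert a S : Finset ℝ) ≤ b - a :=
      (infDist_le_dist_of_mem (Finset.mem_coe.2 (Finset.mem_insert_self a S))).trans
        (by rw [Real.dist_eq, abs_of_nonneg (sub_nonneg.2 ht.1)]; linarith [ht.2])
    exact (mul_le_mul_of_nonneg_left (Real.rpow_le_rpow infDist_nonneg hdist hα.le) hq.le).trans hqm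
  · rw [← mul_sub, abs_mul, abs_of_pos hq]
    exact mul_le_mul hqL (abs_infDist_rpow_sub_le _ hα.le hα1 s t) (abs_nonneg _) hL.le
  · simp only
    rw [infDist_zero_of_mem (Finset.mem_coe.2 (Finset.mem_insert_of_mem ht)),
      Real.zero_rpow hα.ne', mul_zero]
  · rw [intervalIntegral.integral_const_mul, mul_assoc]
    exact mul_le_mul_of_nonneg_left (le_integral_infDist_insert_rpow hab.le hα.le hn hS) hq.le

/-- The evaluation point number `j` that the algorithm `A` uses on the data `(x, g)`. -/
def Algorithm.node (A : Algorithm a b d) (x : Vec d) (g : RHS a b d) (j : ℕ) : Icc a b × Vec d :=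
  A.point j (A.observed x g j) x

theorem Algorithm.observed_congr (A : Algorithm a b d) {x : Vec d} {f g : RHS a b d} {j : ℕ}
    (h : ∀ i < j, f (A.node x g i) = g (A.node x g i)) : A.observed x f j = A.observed x g j := by
  induction j with
  | zero => rfl
  | succ j ih =>
    rw [Algorithm.observed, Algorithm.observed, ih fun i hi => h i (hi.trans j.lt_succ_self)]
    exact congrArg _ (h j j.lt_succ_self)

theorem Algorithm.run_congr (A : Algorithm a b d) {x : Vec d} {f g : RHS a b d}
    (h : ∀ j < A.card, f (A.node x g j) = g (A.node x g j)) : A.run x f = A.run x g := by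
  rw [Algorithm.run, Algorithm.run, A.observed_congr h]

theorem mem_noisyData_self (hδ : 0 ≤ δ) {x : Vec d} (hx : ‖x - ξ‖ ≤ δ) (g : RHS a b d) :
    (x, g) ∈ noisyData ξ g δ :=
  ⟨hx, 0, ⟨measurable_zero, fun t y => by simpa using by positivity⟩, (add_zero g).symm⟩

theorem edist_solution_le_worstCaseError {M : Method a b d} {G : Set (Vec d × RHS a b d)}
    {p q : Vec d × RHS a b d} (hp : p ∈ G) (hq : q ∈ noisyData p.1 p.2 δ) (t : Icc a b) :
    edist (solution p.1 p.2 t) (M q.1 q.2 t) ≤ worstCaseError M G δ :=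
  calc edist (solution p.1 p.2 t) (M q.1 q.2 t)
      = ‖solution p.1 p.2 t - M q.1 q.2 t‖ₑ := edist_eq_enorm_sub _ _
    _ ≤ ⨆ s, ‖solution p.1 p.2 s - M q.1 q.2 s‖ₑ :=
        le_iSup (fun s => ‖solution p.1 p.2 s - M q.1 q.2 s‖ₑ) t
    _ ≤ error M p.1 p.2 δ :=
        le_iSup₂ (f := fun q (_ : q ∈ noisyData p.1 p.2 δ) =>
          ⨆ s, ‖solution p.1 p.2 s - M q.1 q.2 s‖ₑ) q hq
    _ ≤ worstCaseError M G δ := le_iSup₂ (f := fun p (_ : p ∈ G) => error M p.1 p.2 δ) p hp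

theorem edist_solution_le_two_mul_worstCaseError {M : Method a b d} {G : Set (Vec d × RHS a b d)}
    {p p' q q' : Vec d × RHS a b d} (hp : p ∈ G) (hp' : p' ∈ G) (hq : q ∈ noisyData p.1 p.2 δ)
    (hq' : q' ∈ noisyData p'.1 p'.2 δ) (hM : M q.1 q.2 = M q'.1 q'.2) (t : Icc a b) :
    edist (solution p.1 p.2 t) (solution p'.1 p'.2 t) ≤ 2 * worstCaseError M G δ := by
  rw [two_mul]
  refine (edist_triangle_right _ _ (M q.1 q.2 t)).trans
    (add_le_add (edist_solution_le_worstCaseError hp hq t) ?_)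
  rw [hM]
  exact edist_solution_le_worstCaseError hp' hq' t

theorem Algorithm.ofReal_le_worstCaseError_of_node_eq_zero [NeZero d] (A : Algorithm a b d)
    (hab : a ≤ b) (hα : α ≠ 0) (hR : (1 + K) * Real.exp (K * (b - a)) ≤ 1 + R) (hδ : 0 ≤ δ)
    (hκ : κ ≤ 0) (hφ : Continuous φ) (hφ0 : ∀ t ∈ Icc a b, 0 ≤ φ t)
    (hnode : ∀ j < A.card, φ (A.node 0 (forcedLinearRHS a b κ R 0 0) j).1 = 0)
    (hclass : ∀ ξ v : Vec d, ‖ξ‖ = δ → ‖v‖ = 1 →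
      InClass a b d α 1 K H L R ξ (forcedLinearRHS a b κ R v φ)) :
    ENNReal.ofReal (Real.exp (κ * (b - a)) * (δ + ∫ t in a..b, φ t)) ≤
      worstCaseError A.run (problemClass a b d α 1 K H L R) δ := by
  let z : Vec d → Vec d := fun v =>
    solution (δ • v) (forcedLinearRHS a b κ R v φ) ⟨b, right_mem_Icc.2 hab⟩
  have hδv : ∀ v : Vec d, ‖v‖ = 1 → ‖δ • v‖ = δ := fun v hv => by
    rw [norm_smul, hv, mul_one, Real.norm_of_nonneg hδ]
  have hz : ∀ v : Vec d, ‖v‖ = 1 →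
      Real.exp (κ * (b - a)) * (δ + ∫ t in a..b, φ t) ≤ inner ℝ v (z v) := fun v hv => by
    have h := exp_mul_add_integral_le_inner_solution hab hα hR hv hκ hφ hφ0
      (hclass _ v (hδv v hv) hv)
    rwa [real_inner_smul_right, real_inner_self_eq_norm_sq, hv, one_pow, mul_one] at h
  have hrun : ∀ v, A.run 0 (forcedLinearRHS a b κ R v φ) =
      A.run 0 (forcedLinearRHS a b κ R 0 0) := fun v =>
    A.run_congr fun j hj => by simp [forcedLinearRHS, hnode j hj]
  have hnoisy : ∀ v : Vec d, ‖v‖ = 1 → (0, forcedLinearRHS a b κ R v φ) ∈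
      noisyData (δ • v) (forcedLinearRHS a b κ R v φ) δ := fun v hv =>
    mem_noisyData_self hδ (by rw [zero_sub, norm_neg, hδv v hv]) _
  obtain ⟨v, hv⟩ : ∃ v : Vec d, ‖v‖ = 1 := ⟨EuclideanSpace.single 0 1, by simp⟩
  have hv' : ‖-v‖ = 1 := by rw [norm_neg, hv]
  have hfooled : edist (z v) (z (-v)) ≤
      2 * worstCaseError A.run (problemClass a b d α 1 K H L R) δ :=
    edist_solution_le_two_mul_worstCaseError (p := (δ • v, forcedLinearRHS a b κ R v φ))
      (p' := (δ • -v, forcedLinearRHS a b κ R (-v) φ)) (hclass _ _ (hδv v hv) hv)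
      (hclass _ _ (hδv _ hv') hv') (hnoisy v hv) (hnoisy _ hv') ((hrun v).trans (hrun (-v)).symm) _
  have hsep : 2 * (Real.exp (κ * (b - a)) * (δ + ∫ t in a..b, φ t)) ≤ dist (z v) (z (-v)) := by
    have hcs := real_inner_le_norm v (z v - z (-v))
    rw [hv, one_mul, ← dist_eq_norm, inner_sub_right, sub_eq_add_neg, ← inner_neg_left] at hcs
    linarith [hz v hv, hz (-v) hv']
  rw [← ENNReal.mul_le_mul_iff_right two_ne_zero ENNReal.ofNat_ne_top]
  calc 2 * ENNReal.ofReal (Real.exp (κ * (b - a)) * (δ + ∫ t in a..b, φ t))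
      = ENNReal.ofReal (2 * (Real.exp (κ * (b - a)) * (δ + ∫ t in a..b, φ t))) := by
        rw [ENNReal.ofReal_mul zero_le_two, ENNReal.ofReal_ofNat]
    _ ≤ edist (z v) (z (-v)) := by
        rw [edist_dist]
        exact ENNReal.ofReal_le_ofReal hsep
    _ ≤ _ := hfooled

theorem exists_le_minimalError [NeZero d] (hab : a < b) (hα : 0 < α) (hα1 : α ≤ 1)
    (hK : 0 < K) (hL : 0 < L) (hR : (1 + K) * Real.exp (K * (b - a)) ≤ 1 + R) (hHL : -L ≤ H)
    (hHK : -(K * (1 + R)) < H * R) :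
    ∃ c > 0, ∀ n : ℕ, n ≠ 0 → ∀ δ ∈ Icc 0 K, ENNReal.ofReal (c * ((n : ℝ) ^ (-α) + δ)) ≤
      minimalError n (problemClass a b d α 1 K H L R) δ := by
  have hR0 : 0 ≤ R := by
    have : 1 ≤ Real.exp (K * (b - a)) := Real.one_le_exp (by have := sub_pos.2 hab; positivity)
    nlinarith
  obtain ⟨κ, m, hκ, hκL, hκH, hm, hmK, hmR⟩ := exists_rate_and_amplitude hK hL.le hR0 hHL hHK
  obtain ⟨c, hc, hbump⟩ := exists_bump hab hα hα1 hL hm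
  refine ⟨Real.exp (κ * (b - a)) * min c 1, by positivity, fun n hn δ hδ => ?_⟩
  refine le_iInf₂ ?_
  rintro _ ⟨A, hA, rfl⟩
  let times : Finset ℝ := (Finset.range A.card).image fun j =>
    (A.node 0 (forcedLinearRHS a b κ R 0 0) j).1
  obtain ⟨φ, hφ, hφ0, hφm, hφL, hφS, hφint⟩ := hbump n hn times
    (Finset.card_image_le.trans ((Finset.card_range _).trans_le hA))
  refine le_trans (ENNReal.ofReal_le_ofReal ?_) <|
    A.ofReal_le_worstCaseError_of_node_eq_zero hab.le hα.ne' hR hδ.1 hκ hφ (fun t _ => hφ0 t)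
      (fun j hj => hφS _ (Finset.mem_image_of_mem _ (Finset.mem_range.2 hj)))
      fun ξ v hξ hv => inClass_forcedLinearRHS hR0 (hξ.trans_le hδ.2) hv hκL hκH hmK hmR hφ
        (fun t ht => (abs_of_nonneg (hφ0 t)).trans_le (hφm t ht)) hφL
  rw [mul_assoc, mul_add, add_comm δ]
  gcongr ?_ * (?_ + ?_)
  · exact hφint.trans' (by gcongr; exact min_le_left _ _)
  · exact mul_le_of_le_one_left hδ.1 (min_le_right _ _)

end Fooling

theorem one_add_mul_exp_lt_of_radius_le {a b K R : ℝ} (hK : 0 ≤ K) (hR : radius a b K ≤ R) :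
    (1 + K) * Real.exp (K * (b - a)) < 1 + R := by
  have hpos : 0 < Real.exp (K * (b - a)) * (1 + K) := by positivity
  have hradius : Real.exp (K * (b - a)) * (1 + K) * 2 ≤ radius a b K :=
    mul_le_mul_of_nonneg_left (le_max_right _ _) hpos.le
  linarith

end NoisyODE

end

theorem mainTheorem5_general (a b : ℝ) (hab : a < b) (d : ℕ) (hd : 0 < d) (α K H L R : ℝ)
    (hα : 0 < α) (hα1 : α ≤ 1) (hK : 0 < K) (hL : 0 < L)
    (hR : (1 + K) * Real.exp (K * (b - a)) < 1 + R)
    (hHL : -L ≤ H) (hHK : -(K * (1 + R)) < H * R) :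
    (∀ p ∈ problemClass a b d α 1 K H L R, ∃! z, IsSolution p.1 p.2 z) ∧
    (∀ n : ℕ, 1 ≤ n → euler hab.le d n ∈ methods a b d n) ∧
    ∃ c C : ℝ, 0 < c ∧ 0 < C ∧ ∃ (n₀ : ℕ) (δ₀ : ℝ), 0 < δ₀ ∧
      ∀ n : ℕ, n₀ ≤ n → ∀ δ : ℝ, 0 ≤ δ → δ ≤ δ₀ →
        ENNReal.ofReal (c * ((n : ℝ) ^ (-α) + δ)) ≤
          minimalError n (problemClass a b d α 1 K H L R) δ ∧
        minimalError n (problemClass a b d α 1 K H L R) δ ≤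
          ENNReal.ofReal (C * ((n : ℝ) ^ (-α) + δ)) ∧
        worstCaseError (euler hab.le d n) (problemClass a b d α 1 K H L R) δ ≤
          ENNReal.ofReal (C * ((n : ℝ) ^ (-α) + δ)) := by
  have : NeZero d := ⟨hd.ne'⟩
  have hmethod : ∀ n : ℕ, 1 ≤ n → euler hab.le d n ∈ methods a b d n := fun n hn =>
    euler_mem_methods hab.le (Nat.one_le_iff_ne_zero.1 hn)
  obtain ⟨c, hc, hlower⟩ := exists_le_minimalError (d := d) hab hα hα1 hK hL hR.le hHL hHK
  obtain ⟨C, hC, δ₁, hδ₁, heuler⟩ := exists_worstCaseError_euler_le hab d hα hα1 hK.le H hL hR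
  refine ⟨fun p hp => InClass.existsUnique_isSolution hp hab.le hα.ne' hR.le, hmethod,
    c, C, hc, hC, 1, min δ₁ K, lt_min hδ₁ hK, fun n hn δ hδ0 hδ => ?_⟩
  have hn0 : n ≠ 0 := Nat.one_le_iff_ne_zero.1 hn
  have hupper := heuler n hn0 δ ⟨hδ0, hδ.trans (min_le_left _ _)⟩
  exact ⟨hlower n hn0 δ ⟨hδ0, hδ.trans (min_le_right _ _)⟩,
    (iInf₂_le _ (hmethod n hn)).trans hupper, hupper⟩

theorem mainTheorem5 (a b : ℝ) (hab : a < b) (d : ℕ) (hd : 0 < d) (α K H L R : ℝ)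
    (hα : 0 < α) (hα1 : α ≤ 1) (hK : 0 < K) (hL : 0 < L) (hR : radius a b K ≤ R)
    (hHL : -L ≤ H) (hHK : -(K * (1 + R)) < H * R) :
    (∀ p ∈ problemClass a b d α 1 K H L R, ∃! z, IsSolution p.1 p.2 z) ∧
    (∀ n : ℕ, 1 ≤ n → euler hab.le d n ∈ methods a b d n) ∧
    ∃ c C : ℝ, 0 < c ∧ 0 < C ∧ ∃ (n₀ : ℕ) (δ₀ : ℝ), 0 < δ₀ ∧
      ∀ n : ℕ, n₀ ≤ n → ∀ δ : ℝ, 0 ≤ δ → δ ≤ δ₀ →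
        ENNReal.ofReal (c * ((n : ℝ) ^ (-α) + δ)) ≤
          minimalError n (problemClass a b d α 1 K H L R) δ ∧
        minimalError n (problemClass a b d α 1 K H L R) δ ≤
          ENNReal.ofReal (C * ((n : ℝ) ^ (-α) + δ)) ∧
        worstCaseError (euler hab.le d n) (problemClass a b d α 1 K H L R) δ ≤
          ENNReal.ofReal (C * ((n : ℝ) ^ (-α) + δ)) := by
  exact mainTheorem5_general a b hab d hd α K H L R hα hα1 hK hL
    (one_add_mul_exp_lt_of_radius_le hK.le hR) hHL hHK
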